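/- Let $N\ge 0$ and $n\ge 1$ be integers, $\tau\in\mathbb C$ with $\operatorname{Im}\tau>0$, and $\eta,c\in\mathbb C$ with $c\neq 0$. Put $$\vartheta(z)=-\sum_{j\in\mathbb Z}\exp\Big(\pi\imath\tau (j+\tfrac12)^2+2\pi\imath (j+\tfrac12)(z+\tfrac12)\Big),\qquad \phi(z,u)=\frac{\vartheta'(0)\,\vartheta(z+u)}{\vartheta(z)\,\vartheta(u)},\qquad E_1(u)=\frac{\vartheta'(u)}{\vartheta(u)} .$$ The phase space $\mathbb C^{2Nn}$ has coordinates $p^a_i,q^a_i$ ($1\le i\le N$; the site $a$ is taken modulo $n$) and the canonical Poisson bracket $\{p^a_i,q^b_j\}=\delta^{ab}\delta_{ij}$, $\{p^a_i,p^b_j\}=\{q^a_i,q^b_j\}=0$. The Lax matrices $L^a(z)\in{\rm Mat}(N,\mathbb C)$ of the periodic ${\rm GL}_N$ elliptic Ruijsenaars chain on $n$ sites are $$L^a_{ij}(z)=\phi(z,q^{a-1}_i-q^a_j+\eta)\,\frac{\prod_{l=1}^N\vartheta(q^a_j-q^{a-1}_l-\eta)}{\vartheta(-\eta)\prod_{l\ne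 j}\vartheta(q^a_j-q^a_l)}\,e^{p^a_j/c}.$$ For matrices write $A_1=A\otimes 1$, $A_2=1\otimes A$, let $E_{ij}$ be the matrix units, let $M_{21}$ be obtained from $M_{12}$ by interchanging the two tensor components, and let $\{A_1,B_2\}=\sum_{i,j,k,l}\{A_{ij},B_{kl}\}\,E_{ij}\otimes E_{kl}$. Define $$r^a_{12}(z,w)=\sum_{i\ne j}\phi(z-w,q^a_i-q^a_j)E_{ij}\otimes E_{ji}+E_1(z-w)\sum_i E_{ii}\otimes E_{ii}-\sum_{i\neq j}E_1(q^a_i-q^a_j)E_{ii}\otimes E_{jj},$$ $$u^{+,a}_{12}=\sum_{i,j}E_1(q^{a-1}_j-q^a_i+\eta)E_{ii}\otimes E_{jj},\qquad u^{-,a}_{12}=-\sum_{i,j}E_1(q^{a-1}_i-q^a_j+\eta)E_{ii}\otimes E_{jj},$$ $$s^a_{12}(z)=\sum_{i,j,m}\big(L^a(z)^{-1}\big)_{mi}\,L^a_{ij}(z)\big(E_1(z+q^{a-1}_i-q^a_j+\eta)-E_1(q^{a-1}_i-q^a_j+\eta)\big)E_{mj}\otimes E_{ii},$$ $$s^{+,a}_{12}(z)=s^a_{12}(z)+u^{+,a}_{12},\qquad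 s^{-,a}_{12}(w)=s^a_{21}(w)-u^{-,a}_{12}.$$ Let $a,b$ be sites, $z,w\in\mathbb C$, and consider a point of the phase space at which everything involved is defined: $\vartheta$ does not vanish at $\eta$, $z$, $w$, $z-w$, nor at $q^d_i-q^d_j$ ($i\ne j$) and $q^{d-1}_i-q^d_j+\eta$ (all $i,j$) for every site $d$, nor at $z+q^{a-1}_i-q^a_j+\eta$ and $w+q^{b-1}_i-q^b_j+\eta$ (all $i,j$), and $\det L^a(z)\ne0$, $\det L^b(w)\neq 0$. Then the entries of $L^a(z)$ and $L^b(w)$ are differentiable there, $$L^a_1(z)s^a_{12}(z)=\sum_{i,j}L^a_{ij}(z)\big(E_1(z+q^{a-1}_i-q^a_j+\eta)-E_1(q^{a-1}_i-q^a_j+\eta)\big)E_{ij}\otimes E_{ii},$$ $$L^b_2(w)s^b_{21}(w)=\sum_{i,j}L^b_{ij}(w)\big(E_1(w+q^{b-1}_i-q^b_j+\eta)-E_1(q^{b-1}_i-q^b_j+\eta)\big)E_{ii}\otimes E_{ij},$$ and $$\begin{aligned}c\{L^a_1(z),L^b_2(w)\}={}&\delta^{ab}\Big(L^b_1(z)L^b_2(w)r^b_{12}(z,w)-r^{b-1}_{12}(z,w)L^b_1(z)L^b_2(w)\\&\quad+L^b_1(z)s^{+,b}_{12}(z)L^b_2(w)-L^b_2(w)s^{-,b}_{12}(w)L^b_1(z)\Big)\\&+\delta^{a,b-1}L^{b-1}_1(z)L^b_2(w)s^{-,b}_{12}(w)-\delta^{a,b+1}L^{b+1}_1(z)L^b_2(w)s^{+,b+1}_{12}(z),\end{aligned}$$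 where the symbols $\delta^{ab}$, $\delta^{a,b-1}$, $\delta^{a,b+1}$ are understood modulo $n$ (so several of them can equal $1$ at once when $n\le 2$). -/

import Mathlib

open scoped Kronecker

namespace RuijsenaarsChain

noncomputable section

/-! Elliptic functions with modular parameter `τ`, `0 < Im τ`. -/

/-- The theta function with characteristics `a`, `b`:
`∑_{j ∈ ℤ} exp (2πi (j+a)² τ/2 + 2πi (j+a)(z+b))`. -/
def thetaChar (a b τ z : ℂ) : ℂ :=
  ∑' j : ℤ, Complex.exp
    (2 * Real.pi * Complex.I * ((j : ℂ) + a) ^ 2 * (τ / 2)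
      + 2 * Real.pi * Complex.I * ((j : ℂ) + a) * (z + b))

/-- The odd (first) Jacobi theta function. -/
def theta (τ z : ℂ) : ℂ := -thetaChar (1 / 2) (1 / 2) τ z

/-- The Kronecker elliptic function. -/
def phi (τ z u : ℂ) : ℂ :=
  deriv (theta τ) 0 * theta τ (z + u) / (theta τ z * theta τ u)

/-- The first Eisenstein function, the logarithmic derivative of `theta`. -/
def E1 (τ u : ℂ) : ℂ := deriv (theta τ) u / theta τ u

/-! The phase space and the canonical Poisson bracket. -/

/-- The phase space `ℂ^{2Nn}`: a point is the pair `(p, q)` of momenta and coordinates,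
both indexed by a site (modulo `n`) and a particle number. -/
abbrev PhaseSpace (N n : ℕ) : Type :=
  (ZMod n → Fin N → ℂ) × (ZMod n → Fin N → ℂ)

variable {N n : ℕ}

/-- The momentum `p^a_i`. -/
def mom (x : PhaseSpace N n) (a : ZMod n) (i : Fin N) : ℂ := x.1 a i

/-- The coordinate `q^a_i`. -/
def pos (x : PhaseSpace N n) (a : ZMod n) (i : Fin N) : ℂ := x.2 a i

/-- The partial derivative with respect to `p^a_i`. -/
def dMom [NeZero n] (F : PhaseSpace N n → ℂ) (a : ZMod n) (i : Fin N)
    (x : PhaseSpace N n) : ℂ :=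
  fderiv ℂ F x (Pi.single a (Pi.single i 1), 0)

/-- The partial derivative with respect to `q^a_i`. -/
def dPos [NeZero n] (F : PhaseSpace N n → ℂ) (a : ZMod n) (i : Fin N)
    (x : PhaseSpace N n) : ℂ :=
  fderiv ℂ F x (0, Pi.single a (Pi.single i 1))

/-- The canonical Poisson bracket, normalized by `{p^a_i, q^b_j} = δ^{ab} δ_{ij}`. -/
def bracket [NeZero n] (F G : PhaseSpace N n → ℂ) (x : PhaseSpace N n) : ℂ :=
  ∑ a : ZMod n, ∑ i : Fin N,
    (dMom F a i x * dPos G a i x - dPos F a i x * dMom G a i x)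

/-! Tensor notation: `Mat(N) ⊗ Mat(N)` is realized through the Kronecker product. -/

/-- `Mat(N, ℂ)`. -/
abbrev Mat (N : ℕ) : Type := Matrix (Fin N) (Fin N) ℂ

/-- `Mat(N, ℂ) ⊗ Mat(N, ℂ)`. -/
abbrev Mat2 (N : ℕ) : Type := Matrix (Fin N × Fin N) (Fin N × Fin N) ℂ

/-- `E_{ij} ⊗ E_{kl}` for the matrix units `E_{ij}`. -/
def EE (i j k l : Fin N) : Mat2 N :=
  Matrix.single i j (1 : ℂ) ⊗ₖ Matrix.single k l (1 : ℂ)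

/-- `A_1 = A ⊗ 1`. -/
def leg1 (A : Mat N) : Mat2 N := A ⊗ₖ (1 : Mat N)

/-- `A_2 = 1 ⊗ A`. -/
def leg2 (A : Mat N) : Mat2 N := (1 : Mat N) ⊗ₖ A

/-- Interchange of the two tensor components, `M_{12} ↦ M_{21}`
(so `A ⊗ B` goes to `B ⊗ A`). -/
def swap12 (M : Mat2 N) : Mat2 N := M.submatrix Prod.swap Prod.swap

/-- `{A_1, B_2} = ∑ {A_{ij}, B_{kl}} E_{ij} ⊗ E_{kl}`. -/
def bracket12 [NeZero n] (A B : PhaseSpace N n → Mat N) (x : PhaseSpace N n) : Mat2 N :=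
  ∑ i, ∑ j, ∑ k, ∑ l,
    bracket (fun y => A y i j) (fun y => B y k l) x • EE i j k l

/-! The chain. The parameters are `τ`, `η`, `c`. -/

/-- The Lax matrix `L^a(z)` at the phase space point `x`. -/
def lax (τ η c : ℂ) (a : ZMod n) (z : ℂ) (x : PhaseSpace N n) : Mat N :=
  Matrix.of fun i j =>
    phi τ z (pos x (a - 1) i - pos x a j + η)
      * ((∏ l, theta τ (pos x a j - pos x (a - 1) l - η))
        / (theta τ (-η) * ∏ l ∈ Finset.univ.erase j, theta τ (pos x a j - pos x a l)))
      * Complex.exp (mom x a j / c)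

/-- The `η`-derivative of `L^a(z)` acting on the function `φ` only:
`L^a_{ij}(z) (E₁(z + q^{a-1}_i - q^a_j + η) - E₁(q^{a-1}_i - q^a_j + η))`. -/
def dLax (τ η c : ℂ) (a : ZMod n) (z : ℂ) (x : PhaseSpace N n) : Mat N :=
  Matrix.of fun i j =>
    lax τ η c a z x i j
      * (E1 τ (z + pos x (a - 1) i - pos x a j + η)
        - E1 τ (pos x (a - 1) i - pos x a j + η))

/-- `r^a_{12}(z, w)`. -/
def rMat (τ : ℂ) (a : ZMod n) (z w : ℂ) (x : PhaseSpace N n) : Mat2 N :=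
  (∑ i, ∑ j, if i ≠ j then phi τ (z - w) (pos x a i - pos x a j) • EE i j j i else 0)
    + E1 τ (z - w) • (∑ i, EE i i i i)
    - ∑ i, ∑ j, if i ≠ j then E1 τ (pos x a i - pos x a j) • EE i i j j else 0

/-- `s^a_{12}(z) = ∑ (L^a(z)⁻¹)_{mi} (dL^a(z))_{ij} E_{mj} ⊗ E_{ii}`; where `L^a(z)` is
invertible, this is the solution of
`L^a_1(z) s^a_{12}(z) = ∑ (dL^a(z))_{ij} E_{ij} ⊗ E_{ii}`. -/
def sMat (τ η c : ℂ) (a : ZMod n) (z : ℂ) (x : PhaseSpace N n) : Mat2 N :=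
  ∑ i, ∑ j, ∑ m,
    ((lax τ η c a z x)⁻¹ m i * dLax τ η c a z x i j) • EE m j i i

/-- `u^{+,a}_{12}`. -/
def uPlus (τ η : ℂ) (a : ZMod n) (x : PhaseSpace N n) : Mat2 N :=
  ∑ i, ∑ j, E1 τ (pos x (a - 1) j - pos x a i + η) • EE i i j j

/-- `u^{-,a}_{12}`. -/
def uMinus (τ η : ℂ) (a : ZMod n) (x : PhaseSpace N n) : Mat2 N :=
  -∑ i, ∑ j, E1 τ (pos x (a - 1) i - pos x a j + η) • EE i i j j

/-- `s^{+,a}_{12}(z) = s^a_{12}(z) + u^{+,a}_{12}`. -/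
def sPlus (τ η c : ℂ) (a : ZMod n) (z : ℂ) (x : PhaseSpace N n) : Mat2 N :=
  sMat τ η c a z x + uPlus τ η a x

/-- `s^{-,a}_{12}(w) = s^a_{21}(w) - u^{-,a}_{12}`. -/
def sMinus (τ η c : ℂ) (a : ZMod n) (w : ℂ) (x : PhaseSpace N n) : Mat2 N :=
  swap12 (sMat τ η c a w x) - uMinus τ η a x

/-- The Kronecker symbol of sites, that is, modulo `n`. -/
def siteDelta (a b : ZMod n) : ℂ := if a = b then 1 else 0

end

end RuijsenaarsChain

open RuijsenaarsChain

/-!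
The proof computes both sides of the quadratic relation matrix element by matrix element.

Each entry `L^a_{ij}(z)` is a product of theta functions of linear forms and an exponential, so its
derivative is the entry times the linear form `dlogLax`. Since the momentum `p^a_j` enters
column `j` only, as `exp (p^a_j / c)`, the bracket `c {L^a_{ij}(z), L^b_{kl}(w)}` is the product of
the two entries times `∂ log L^b_{kl}(w) / ∂q^a_j - ∂ log L^a_{ij}(z) / ∂q^b_l` (`bracket_lax`).
A coordinate derivative has a contribution from `q^a` and one from `q^{a-1}` (`dlogLax_pos`), and
keeping these apart makes the argument uniform in `n`: the terms with different Kronecker symbols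
of sites can be compared separately even if several symbols equal `1`.

The terms with neighbouring sites agree at once, because `L_1 s_{12}` contains no inverse
matrix. In the terms with equal sites the derivatives of the factor of `L` without spectral
parameter cancel if `j = l`, and what remains is trivial if `i = k` and `j = l`, while the other
cases are the identities `E1_mul_phi_mul_phi_of_sub` and `E1_mul_phi_mul_phi` for the Kronecker
function (`lax_exchange`).

Both identities follow from Weierstrass' three-term relation for theta (`theta_three_term`) and
its derivative (`theta_three_term_deriv`), which writes `E₁(x) + E₁(y) + E₁(t) - E₁(x + y + t)` as
a quotient of theta functions. The three-term relation is a Plücker relation: by rearranging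
the double series, `θ(x + y) θ(x - y) = A(x) B(y) - B(x) A(y)` for two functions `A`, `B`
built from theta functions of modulus `2τ`.
-/

namespace RuijsenaarsChain

/-! ### Theta function identities -/

/-- A sum over pairs `(j, k)` splits by the parity of `j + k`, the pairs in each half being
indexed by half the sum and half the difference of `j` and `k`, both rounded down. -/
lemma hasSum_int_prod_of_add_sub {F : ℤ × ℤ → ℂ} {A B : ℂ}
    (hA : HasSum (fun p : ℤ × ℤ => F (p.1 + p.2, p.1 - p.2)) A)
    (hB : HasSum (fun p : ℤ × ℤ => F (p.1 + p.2 + 1, p.1 - p.2)) B) :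
    HasSum F (A + B) := by
  let e : ℤ × ℤ → ℤ × ℤ := fun p => (p.1 + p.2, p.1 - p.2)
  let o : ℤ × ℤ → ℤ × ℤ := fun p => (p.1 + p.2 + 1, p.1 - p.2)
  have he : Function.Injective e := by
    rintro ⟨a, b⟩ ⟨c, d⟩ h
    simp only [e, Prod.mk.injEq] at h ⊢
    omega
  have ho : Function.Injective o := by
    rintro ⟨a, b⟩ ⟨c, d⟩ h
    simp only [o, Prod.mk.injEq] at h ⊢
    omega
  have hcompl : IsCompl (Set.range e) (Set.range o) := by
    constructor
    · rw [Set.disjoint_left]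
      rintro _ ⟨⟨a, b⟩, rfl⟩ ⟨⟨c, d⟩, h⟩
      simp only [e, o, Prod.mk.injEq] at h
      omega
    · rw [codisjoint_iff, Set.top_eq_univ, Set.eq_univ_iff_forall]
      rintro ⟨j, k⟩
      rcases Int.even_or_odd (j + k) with ⟨m, hm⟩ | ⟨m, hm⟩
      · refine Or.inl ⟨(m, j - m), ?_⟩
        simp only [e, Prod.mk.injEq]
        omega
      · refine Or.inr ⟨(m, j - m - 1), ?_⟩
        simp only [o, Prod.mk.injEq]
        omega
  exact (he.hasSum_range_iff.mpr hA).add_isCompl hcompl (ho.hasSum_range_iff.mpr hB)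

lemma hasSum_mul_of_hasSum {ι κ : Type*} {f : ι → ℂ} {g : κ → ℂ} {a b : ℂ}
    (hf : HasSum f a) (hg : HasSum g b) : HasSum (fun p : ι × κ => f p.1 * g p.2) (a * b) := by
  rw [← hf.tsum_eq, ← hg.tsum_eq,
    tsum_mul_tsum_of_summable_norm hf.summable.norm hg.summable.norm]
  exact (summable_mul_of_summable_norm hf.summable.norm hg.summable.norm).hasSum

lemma hasSum_jacobiTheta₂_term_mul {τ : ℂ} (hτ : 0 < τ.im) (u v : ℂ) :
    HasSum (fun p : ℤ × ℤ => jacobiTheta₂_term p.1 u τ * jacobiTheta₂_term p.2 v τ)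
      (jacobiTheta₂ u τ * jacobiTheta₂ v τ) :=
  hasSum_mul_of_hasSum (f := fun j => jacobiTheta₂_term j u τ)
    (g := fun k => jacobiTheta₂_term k v τ)
    (hasSum_jacobiTheta₂_term u hτ) (hasSum_jacobiTheta₂_term v hτ)

/-- Products of two Jacobi theta functions in terms of theta functions of doubled modulus: the
summation indices `j`, `k` are replaced by `j + k` and `j - k`, which have equal parity. -/
lemma jacobiTheta₂_mul {τ : ℂ} (hτ : 0 < τ.im) (x y : ℂ) :
    jacobiTheta₂ (x + y) τ * jacobiTheta₂ (x - y) τ =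
      jacobiTheta₂ (2 * x) (2 * τ) * jacobiTheta₂ (2 * y) (2 * τ)
        + Complex.exp (2 * Real.pi * Complex.I * (x + y) + Real.pi * Complex.I * τ)
          * (jacobiTheta₂ (2 * x + τ) (2 * τ) * jacobiTheta₂ (2 * y + τ) (2 * τ)) := by
  have h2τ : 0 < (2 * τ).im := by simpa using hτ
  refine (hasSum_jacobiTheta₂_term_mul hτ (x + y) (x - y)).unique
    (hasSum_int_prod_of_add_sub ?_ ?_)
  · refine (hasSum_jacobiTheta₂_term_mul h2τ (2 * x) (2 * y)).congr_fun fun p => ?_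
    simp only [jacobiTheta₂_term, ← Complex.exp_add]
    congr 1
    push_cast
    ring
  · refine ((hasSum_jacobiTheta₂_term_mul h2τ (2 * x + τ) (2 * y + τ)).mul_left _).congr_fun
      fun p => ?_
    simp only [jacobiTheta₂_term, ← Complex.exp_add]
    congr 1
    push_cast
    ring

lemma theta_eq_jacobiTheta₂ (τ z : ℂ) :
    theta τ z = -(Complex.exp (Real.pi * Complex.I * τ / 4 + Real.pi * Complex.I * (z + 1 / 2))
      * jacobiTheta₂ (z + 1 / 2 + τ / 2) τ) := by
  rw [theta, thetaChar, jacobiTheta₂, ← tsum_mul_left]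
  congr 1
  refine tsum_congr fun j => ?_
  rw [jacobiTheta₂_term, ← Complex.exp_add]
  congr 1
  ring

lemma differentiable_theta {τ : ℂ} (hτ : 0 < τ.im) : Differentiable ℂ (theta τ) := by
  have hJ : Differentiable ℂ (fun z => jacobiTheta₂ z τ) := fun z =>
    differentiableAt_jacobiTheta₂_fst z hτ
  have h : theta τ = fun z =>
      -(Complex.exp (Real.pi * Complex.I * τ / 4 + Real.pi * Complex.I * (z + 1 / 2))
        * (fun z => jacobiTheta₂ z τ) (z + 1 / 2 + τ / 2)) := funext (theta_eq_jacobiTheta₂ τ)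
  rw [h]
  fun_prop

lemma theta_neg (τ z : ℂ) : theta τ (-z) = -theta τ z := by
  have h : jacobiTheta₂ (-z + 1 / 2 + τ / 2) τ
      = -(Complex.exp (2 * Real.pi * Complex.I * z) * jacobiTheta₂ (z + 1 / 2 + τ / 2) τ) := by
    rw [show -z + 1 / 2 + τ / 2 = -(z - 1 / 2 - τ / 2) by ring, jacobiTheta₂_neg_left,
      show z + 1 / 2 + τ / 2 = z - 1 / 2 - τ / 2 + τ + 1 by ring, jacobiTheta₂_add_left,
      jacobiTheta₂_add_left', ← mul_assoc, ← Complex.exp_add,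
      show 2 * Real.pi * Complex.I * z + -Real.pi * Complex.I * (τ + 2 * (z - 1 / 2 - τ / 2))
        = Real.pi * Complex.I by ring, Complex.exp_pi_mul_I]
    ring
  rw [theta_eq_jacobiTheta₂, theta_eq_jacobiTheta₂, h, mul_neg, ← mul_assoc, ← Complex.exp_add,
    show Real.pi * Complex.I * τ / 4 + Real.pi * Complex.I * (-z + 1 / 2)
        + 2 * Real.pi * Complex.I * z
      = Real.pi * Complex.I * τ / 4 + Real.pi * Complex.I * (z + 1 / 2) by ring]

lemma theta_zero (τ : ℂ) : theta τ 0 = 0 := by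
  have h := theta_neg τ 0
  rw [neg_zero] at h
  exact self_eq_neg.mp h

/-- The product `θ(x + y) θ(x - y)` is a `2 × 2` determinant in functions of `x` and `y`. -/
lemma exists_theta_mul_theta_eq {τ : ℂ} (hτ : 0 < τ.im) :
    ∃ A B : ℂ → ℂ, ∀ x y, theta τ (x + y) * theta τ (x - y) = A x * B y - B x * A y := by
  refine ⟨fun x => jacobiTheta₂ (2 * x) (2 * τ), fun x =>
    Complex.exp (Real.pi * Complex.I * τ / 2 + 2 * Real.pi * Complex.I * x)
      * jacobiTheta₂ (2 * x + τ) (2 * τ), fun x y => ?_⟩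
  have h := jacobiTheta₂_mul hτ (x + 1 / 2 + τ / 2) y
  rw [show 2 * (x + 1 / 2 + τ / 2) = 2 * x + τ + 1 by ring, jacobiTheta₂_add_left,
    show 2 * x + τ + 1 + τ = 2 * x + 2 * τ + 1 by ring, jacobiTheta₂_add_left,
    jacobiTheta₂_add_left'] at h
  rw [theta_eq_jacobiTheta₂, theta_eq_jacobiTheta₂, neg_mul_neg, mul_mul_mul_comm,
    show x + y + 1 / 2 + τ / 2 = x + 1 / 2 + τ / 2 + y by ring,
    show x - y + 1 / 2 + τ / 2 = x + 1 / 2 + τ / 2 - y by ring, h, ← Complex.exp_add, mul_add]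
  have h1 : Complex.exp (Real.pi * Complex.I * τ / 4 + Real.pi * Complex.I * (x + y + 1 / 2)
        + (Real.pi * Complex.I * τ / 4 + Real.pi * Complex.I * (x - y + 1 / 2)))
      = -Complex.exp (Real.pi * Complex.I * τ / 2 + 2 * Real.pi * Complex.I * x) := by
    rw [neg_eq_neg_one_mul, ← Complex.exp_pi_mul_I, ← Complex.exp_add]
    congr 1
    ring
  have h2 : Complex.exp (Real.pi * Complex.I * τ / 2 + 2 * Real.pi * Complex.I * x)
        * Complex.exp (2 * Real.pi * Complex.I * (x + 1 / 2 + τ / 2 + y) + Real.pi * Complex.I * τ)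
        * Complex.exp (-Real.pi * Complex.I * (2 * τ + 2 * (2 * x)))
      = Complex.exp (Real.pi * Complex.I)
        * Complex.exp (Real.pi * Complex.I * τ / 2 + 2 * Real.pi * Complex.I * y) := by
    rw [← Complex.exp_add, ← Complex.exp_add, ← Complex.exp_add]
    congr 1
    ring
  rw [Complex.exp_pi_mul_I] at h2
  rw [h1]
  linear_combination (-jacobiTheta₂ (2 * x) (2 * τ) * jacobiTheta₂ (2 * y + τ) (2 * τ)) * h2

/-- Weierstrass' three-term relation: the Plücker relation for the determinants
of `exists_theta_mul_theta_eq`. -/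
lemma theta_three_term {τ : ℂ} (hτ : 0 < τ.im) (u v s t : ℂ) :
    theta τ (u + v) * theta τ (u - v) * (theta τ (s + t) * theta τ (s - t))
      + theta τ (u + s) * theta τ (u - s) * (theta τ (t + v) * theta τ (t - v))
      + theta τ (u + t) * theta τ (u - t) * (theta τ (v + s) * theta τ (v - s)) = 0 := by
  obtain ⟨A, B, h⟩ := exists_theta_mul_theta_eq hτ
  simp only [h]
  ring

lemma deriv_theta_neg (τ z : ℂ) :
    deriv (theta τ) (-z) = deriv (theta τ) z := by
  have h := deriv_comp_neg (theta τ) z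
  have h' : (fun z => theta τ (-z)) = fun z => -theta τ z := funext (theta_neg τ)
  rw [h', deriv.fun_neg] at h
  exact (neg_injective h).symm

lemma E1_neg (τ z : ℂ) : E1 τ (-z) = -E1 τ z := by
  rw [E1, E1, deriv_theta_neg, theta_neg, div_neg]

/-- The derivative of the three-term relation in `u` at `u = t`. -/
lemma theta_three_term_deriv {τ : ℂ} (hτ : 0 < τ.im) (v s t : ℂ) :
    (deriv (theta τ) (t + v) * theta τ (t - v) + theta τ (t + v) * deriv (theta τ) (t - v))
        * (theta τ (s + t) * theta τ (s - t))
      + (deriv (theta τ) (t + s) * theta τ (t - s) + theta τ (t + s) * deriv (theta τ) (t - s))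
        * (theta τ (t + v) * theta τ (t - v))
      + theta τ (2 * t) * deriv (theta τ) 0 * (theta τ (v + s) * theta τ (v - s)) = 0 := by
  have hd : ∀ a, HasDerivAt (fun u => theta τ (u + a)) (deriv (theta τ) (t + a)) t := fun a =>
    ((differentiable_theta hτ) (t + a)).hasDerivAt.comp_add_const t a
  have hp : ∀ a, HasDerivAt (fun u => theta τ (u + a) * theta τ (u - a))
      (deriv (theta τ) (t + a) * theta τ (t - a) + theta τ (t + a) * deriv (theta τ) (t - a)) t := by
    intro a
    simpa only [← sub_eq_add_neg] using (hd a).fun_mul (hd (-a))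
  have h := (((hp v).mul_const (theta τ (s + t) * theta τ (s - t))).fun_add
    ((hp s).mul_const (theta τ (t + v) * theta τ (t - v)))).fun_add
    ((hp t).mul_const (theta τ (v + s) * theta τ (v - s)))
  simp only [theta_three_term hτ] at h
  have h0 := h.unique (hasDerivAt_const t 0)
  simp only [sub_self, theta_zero, mul_zero, zero_add, ← two_mul] at h0
  exact h0

/-- The degenerate three-term relation, solved for the sum of the functions `E₁`. -/
lemma E1_add_add_sub {τ : ℂ} (hτ : 0 < τ.im) {x y t : ℂ} (hx : theta τ x ≠ 0)
    (hy : theta τ y ≠ 0) (ht : theta τ t ≠ 0) (hxyt : theta τ (x + y + t) ≠ 0) :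
    E1 τ x + E1 τ y + E1 τ t - E1 τ (x + y + t)
      = deriv (theta τ) 0 * (theta τ (x + y) * theta τ (y + t) * theta τ (x + t))
        / (theta τ x * theta τ y * theta τ t * theta τ (x + y + t)) := by
  have h := theta_three_term_deriv hτ ((x - y) / 2) ((x + y) / 2 + t) ((x + y) / 2)
  rw [show (x + y) / 2 + (x - y) / 2 = x by ring, show (x + y) / 2 - (x - y) / 2 = y by ring,
    show (x + y) / 2 + t + (x + y) / 2 = x + y + t by ring,
    show (x + y) / 2 + t - (x + y) / 2 = t by ring,
    show (x + y) / 2 + ((x + y) / 2 + t) = x + y + t by ring,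
    show (x + y) / 2 - ((x + y) / 2 + t) = -t by ring,
    show 2 * ((x + y) / 2) = x + y by ring,
    show (x - y) / 2 + ((x + y) / 2 + t) = x + t by ring,
    show (x - y) / 2 - ((x + y) / 2 + t) = -(y + t) by ring,
    theta_neg, theta_neg, deriv_theta_neg] at h
  unfold E1
  field_simp
  linear_combination h

/-! ### Identities for the Kronecker function -/

/-- The exchange relation for the second arguments `a` and `b` of two Kronecker functions. Here the
sum of the functions `E₁` is a single product, which already has the shape of the right side. -/
lemma E1_mul_phi_mul_phi_of_sub {τ : ℂ} (hτ : 0 < τ.im) {z w a b : ℂ} (hz : theta τ z ≠ 0)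
    (hw : theta τ w ≠ 0) (hzw : theta τ (z - w) ≠ 0) (ha : theta τ a ≠ 0) (hb : theta τ b ≠ 0)
    (hab : theta τ (a - b) ≠ 0) (hza : theta τ (z + a) ≠ 0) (hwb : theta τ (w + b) ≠ 0) :
    (E1 τ (a - b) + E1 τ (z - w) + E1 τ (w + b) - E1 τ (z + a)) * (phi τ z a * phi τ w b)
      = phi τ (z - w) (a - b) * phi τ z b * phi τ w a := by
  have h := E1_add_add_sub hτ (x := w + b) (y := z - w) (t := a - b) hwb hzw hab
    (by rwa [show w + b + (z - w) + (a - b) = z + a by ring])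
  rw [show w + b + (z - w) + (a - b) = z + a by ring, show w + b + (z - w) = z + b by ring,
    show w + b + (a - b) = w + a by ring] at h
  rw [show E1 τ (a - b) + E1 τ (z - w) + E1 τ (w + b) - E1 τ (z + a)
    = E1 τ (w + b) + E1 τ (z - w) + E1 τ (a - b) - E1 τ (z + a) by ring, h]
  unfold phi
  field_simp

/-- The exchange relation for Kronecker functions of four points. After the sum of the
functions `E₁` is written as a product it is the three-term relation. -/
lemma E1_mul_phi_mul_phi {τ : ℂ} (hτ : 0 < τ.im) {z w x y s t : ℂ} (hz : theta τ z ≠ 0)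
    (hw : theta τ w ≠ 0) (hzw : theta τ (z - w) ≠ 0) (hxs : theta τ (x - s) ≠ 0)
    (hxt : theta τ (x - t) ≠ 0) (hys : theta τ (y - s) ≠ 0) (hyt : theta τ (y - t) ≠ 0)
    (hxy : theta τ (x - y) ≠ 0) (hst : theta τ (t - s) ≠ 0) :
    (E1 τ (t - s) - E1 τ (x - y) - E1 τ (y - s) + E1 τ (x - t))
        * (phi τ z (x - s) * phi τ w (y - t))
      = phi τ (z - w) (t - s) * phi τ z (x - t) * phi τ w (y - s)
        - phi τ (z - w) (x - y) * phi τ z (y - s) * phi τ w (x - t) := by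
  have hyx : theta τ (y - x) ≠ 0 := by
    rwa [← neg_sub, theta_neg, neg_ne_zero]
  have h := E1_add_add_sub hτ (x := t - s) (y := x - t) (t := y - x) hst hxt hyx
    (by rwa [show t - s + (x - t) + (y - x) = y - s by ring])
  rw [show t - s + (x - t) + (y - x) = y - s by ring, show t - s + (x - t) = x - s by ring,
    show x - t + (y - x) = y - t by ring, show t - s + (y - x) = t - s - (x - y) by ring,
    ← neg_sub x y, E1_neg, theta_neg] at h
  -- the half-sums and half-differences that make the first product of the three-term relation
  -- `θ(z + (x - s)) θ(w + (y - t)) θ(z - w) θ(t - s - (x - y))`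
  have h3 := theta_three_term hτ ((z + x - s + (w + y - t)) / 2) ((z + x - s - (w + y - t)) / 2)
    ((z - w + (t - s - (x - y))) / 2) ((z - w - (t - s - (x - y))) / 2)
  rw [show (z + x - s + (w + y - t)) / 2 + (z + x - s - (w + y - t)) / 2 = z + (x - s) by ring,
    show (z + x - s + (w + y - t)) / 2 - (z + x - s - (w + y - t)) / 2 = w + (y - t) by ring,
    show (z - w + (t - s - (x - y))) / 2 + (z - w - (t - s - (x - y))) / 2 = z - w by ring,
    show (z - w + (t - s - (x - y))) / 2 - (z - w - (t - s - (x - y))) / 2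
      = t - s - (x - y) by ring] at h3
  rw [show (z + x - s + (w + y - t)) / 2 + (z - w + (t - s - (x - y))) / 2 = z + (y - s) by ring,
    show (z + x - s + (w + y - t)) / 2 - (z - w + (t - s - (x - y))) / 2 = w + (x - t) by ring,
    show (z - w - (t - s - (x - y))) / 2 + (z + x - s - (w + y - t)) / 2 = z - w + (x - y) by ring,
    show (z - w - (t - s - (x - y))) / 2 - (z + x - s - (w + y - t)) / 2 = -(t - s) by ring,
    show (z + x - s + (w + y - t)) / 2 + (z - w - (t - s - (x - y))) / 2 = z + (x - t) by ring,
    show (z + x - s + (w + y - t)) / 2 - (z - w - (t - s - (x - y))) / 2 = w + (y - s) by ring,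
    show (z + x - s - (w + y - t)) / 2 + (z - w + (t - s - (x - y))) / 2 = z - w + (t - s) by ring,
    show (z + x - s - (w + y - t)) / 2 - (z - w + (t - s - (x - y))) / 2 = x - y by ring,
    theta_neg] at h3
  rw [show E1 τ (t - s) - E1 τ (x - y) - E1 τ (y - s) + E1 τ (x - t)
    = E1 τ (t - s) + E1 τ (x - t) + -E1 τ (x - y) - E1 τ (y - s) by ring, h]
  unfold phi
  field_simp
  linear_combination -deriv (theta τ) 0 ^ 3 * h3

/-! ### Logarithmic derivatives of the Lax matrix -/

section LogFDeriv

variable {E : Type*} [NormedAddCommGroup E] [NormedSpace ℂ E]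

/-- `F` is differentiable at `x` with derivative `F x • ℓ`. This says that `ℓ` is the logarithmic
derivative of `F` at `x`, in a form that needs no division and allows `F x = 0`. -/
def HasLogFDerivAt (F : E → ℂ) (ℓ : E →L[ℂ] ℂ) (x : E) : Prop :=
  HasFDerivAt F (F x • ℓ) x

variable {F G : E → ℂ} {ℓ m : E →L[ℂ] ℂ} {x : E}

lemma hasLogFDerivAt_const (C : ℂ) : HasLogFDerivAt (fun _ : E => C) 0 x := by
  unfold HasLogFDerivAt
  exact (hasFDerivAt_const C x).congr_fderiv (by ext v; simp)

lemma HasLogFDerivAt.mul (hF : HasLogFDerivAt F ℓ x) (hG : HasLogFDerivAt G m x) :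
    HasLogFDerivAt (fun y => F y * G y) (ℓ + m) x := by
  unfold HasLogFDerivAt at *
  refine (hF.fun_mul hG).congr_fderiv ?_
  module

lemma HasLogFDerivAt.inv (hF : HasLogFDerivAt F ℓ x) (hx : F x ≠ 0) :
    HasLogFDerivAt (fun y => (F y)⁻¹) (-ℓ) x := by
  unfold HasLogFDerivAt at *
  refine ((hasDerivAt_inv hx).comp_hasFDerivAt x hF).congr_fderiv ?_
  rw [smul_smul, smul_neg, ← neg_smul]
  congr 1
  field_simp

lemma HasLogFDerivAt.div (hF : HasLogFDerivAt F ℓ x) (hG : HasLogFDerivAt G m x)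
    (hx : G x ≠ 0) : HasLogFDerivAt (fun y => F y / G y) (ℓ - m) x := by
  simpa only [div_eq_mul_inv, sub_eq_add_neg] using hF.mul (hG.inv hx)

lemma HasLogFDerivAt.finset_prod {ι : Type*} [DecidableEq ι] {s : Finset ι} {F : ι → E → ℂ}
    {ℓ : ι → E →L[ℂ] ℂ} (h : ∀ i ∈ s, HasLogFDerivAt (F i) (ℓ i) x) :
    HasLogFDerivAt (fun y => ∏ i ∈ s, F i y) (∑ i ∈ s, ℓ i) x := by
  induction s using Finset.induction_on with
  | empty => simpa using hasLogFDerivAt_const 1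
  | insert a s ha ih =>
    simp only [Finset.prod_insert ha, Finset.sum_insert ha]
    exact (h a (Finset.mem_insert_self a s)).mul
      (ih fun i hi => h i (Finset.mem_insert_of_mem hi))

lemma hasLogFDerivAt_exp (hF : HasFDerivAt F ℓ x) :
    HasLogFDerivAt (fun y => Complex.exp (F y)) ℓ x :=
  hF.cexp

lemma hasLogFDerivAt_theta {τ : ℂ} (hτ : 0 < τ.im) (hF : HasFDerivAt F ℓ x)
    (hx : theta τ (F x) ≠ 0) :
    HasLogFDerivAt (fun y => theta τ (F y)) (E1 τ (F x) • ℓ) x := by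
  unfold HasLogFDerivAt
  refine (((differentiable_theta hτ) (F x)).hasDerivAt.comp_hasFDerivAt x hF).congr_fderiv ?_
  rw [smul_smul, E1, mul_div_cancel₀ _ hx]

end LogFDeriv

section Lax

variable {N n : ℕ}

/-- The coordinate function `p^a_i` as a linear form. -/
noncomputable def momL (a : ZMod n) (i : Fin N) : PhaseSpace N n →L[ℂ] ℂ :=
  (ContinuousLinearMap.proj i).comp
    ((ContinuousLinearMap.proj (R := ℂ) (φ := fun _ : ZMod n => Fin N → ℂ) a).comp
      (ContinuousLinearMap.fst ℂ _ _))

/-- The coordinate function `q^a_i` as a linear form. -/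
noncomputable def posL (a : ZMod n) (i : Fin N) : PhaseSpace N n →L[ℂ] ℂ :=
  (ContinuousLinearMap.proj i).comp
    ((ContinuousLinearMap.proj (R := ℂ) (φ := fun _ : ZMod n => Fin N → ℂ) a).comp
      (ContinuousLinearMap.snd ℂ _ _))

lemma momL_apply (a : ZMod n) (i : Fin N) (x : PhaseSpace N n) : momL a i x = mom x a i := rfl

lemma posL_apply (a : ZMod n) (i : Fin N) (x : PhaseSpace N n) : posL a i x = pos x a i := rfl

/-- The factor `E₁(z + q^{a-1}_i - q^a_j + η) - E₁(q^{a-1}_i - q^a_j + η)`, which is the logarithmic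
derivative of `φ(z, q^{a-1}_i - q^a_j + η)` in its second argument. -/
noncomputable def dlogPhi (τ η : ℂ) (a : ZMod n) (z : ℂ) (x : PhaseSpace N n) (i j : Fin N) : ℂ :=
  E1 τ (z + pos x (a - 1) i - pos x a j + η) - E1 τ (pos x (a - 1) i - pos x a j + η)

/-- The logarithmic derivative of the matrix element `L^a_{ij}(z)`. -/
noncomputable def dlogLax (τ η c : ℂ) (a : ZMod n) (z : ℂ) (x : PhaseSpace N n) (i j : Fin N) :
    PhaseSpace N n →L[ℂ] ℂ :=
  dlogPhi τ η a z x i j • (posL (a - 1) i - posL a j)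
    + (∑ l, E1 τ (pos x a j - pos x (a - 1) l - η) • (posL a j - posL (a - 1) l)
      - ∑ l ∈ Finset.univ.erase j, E1 τ (pos x a j - pos x a l) • (posL a j - posL a l))
    + c⁻¹ • momL a j

lemma hasLogFDerivAt_lax [NeZero n] {τ η : ℂ} (c : ℂ) (hτ : 0 < τ.im) (hη : theta τ η ≠ 0)
    {x : PhaseSpace N n}
    (hq : ∀ (a : ZMod n) (i j : Fin N), i ≠ j → theta τ (pos x a i - pos x a j) ≠ 0)
    (hqη : ∀ (a : ZMod n) (i j : Fin N), theta τ (pos x (a - 1) i - pos x a j + η) ≠ 0)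
    {z : ℂ} (hz : theta τ z ≠ 0) {a : ZMod n}
    (hza : ∀ i j : Fin N, theta τ (z + pos x (a - 1) i - pos x a j + η) ≠ 0) (i j : Fin N) :
    HasLogFDerivAt (fun y => lax τ η c a z y i j) (dlogLax τ η c a z x i j) x := by
  have hpos : ∀ (d : ZMod n) (s : Fin N), HasFDerivAt (fun y => pos y d s) (posL d s) x :=
    fun d s => (posL d s).hasFDerivAt
  have hu : HasFDerivAt (fun y => pos y (a - 1) i - pos y a j + η)
      (posL (a - 1) i - posL a j) x := ((hpos _ _).fun_sub (hpos _ _)).add_const η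
  have hzu : theta τ (z + (pos x (a - 1) i - pos x a j + η)) ≠ 0 := by
    rw [show z + (pos x (a - 1) i - pos x a j + η) = z + pos x (a - 1) i - pos x a j + η by ring]
    exact hza i j
  have hnum : ∀ l, theta τ (pos x a j - pos x (a - 1) l - η) ≠ 0 := fun l => by
    rw [show pos x a j - pos x (a - 1) l - η = -(pos x (a - 1) l - pos x a j + η) by ring,
      theta_neg, neg_ne_zero]
    exact hqη a l j
  have hη' : theta τ (-η) ≠ 0 := by rwa [theta_neg, neg_ne_zero]
  have hden : ∀ l ∈ Finset.univ.erase j, theta τ (pos x a j - pos x a l) ≠ 0 := fun l hl =>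
    hq a j l (Finset.ne_of_mem_erase hl).symm
  have h1 := ((hasLogFDerivAt_const (deriv (theta τ) 0)).mul
    (hasLogFDerivAt_theta hτ (hu.const_add z) hzu)).div
    ((hasLogFDerivAt_const (theta τ z)).mul (hasLogFDerivAt_theta hτ hu (hqη a i j)))
    (mul_ne_zero hz (hqη a i j))
  have h2 := HasLogFDerivAt.finset_prod (s := Finset.univ) fun l _ =>
    hasLogFDerivAt_theta hτ (((hpos a j).fun_sub (hpos (a - 1) l)).sub_const η) (hnum l)
  have h3 := HasLogFDerivAt.finset_prod fun l hl =>
    hasLogFDerivAt_theta hτ ((hpos a j).fun_sub (hpos a l)) (hden l hl)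
  have h4 := h2.div ((hasLogFDerivAt_const (theta τ (-η))).mul h3)
    (mul_ne_zero hη' (Finset.prod_ne_zero_iff.mpr hden))
  have h5 : HasFDerivAt (fun y => mom y a j / c) (c⁻¹ • momL a j) x := by
    simp only [div_eq_mul_inv]
    exact ((momL a j).hasFDerivAt (x := x)).mul_const c⁻¹
  have h6 := (h1.mul h4).mul (hasLogFDerivAt_exp h5)
  have h7 : dlogLax τ η c a z x i j = 0 + E1 τ (z + (pos x (a - 1) i - pos x a j + η)) •
        (posL (a - 1) i - posL a j)
      - (0 + E1 τ (pos x (a - 1) i - pos x a j + η) • (posL (a - 1) i - posL a j))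
      + (∑ l, E1 τ (pos x a j - pos x (a - 1) l - η) • (posL a j - posL (a - 1) l)
        - (0 + ∑ l ∈ Finset.univ.erase j, E1 τ (pos x a j - pos x a l) • (posL a j - posL a l)))
      + c⁻¹ • momL a j := by
    rw [show z + (pos x (a - 1) i - pos x a j + η) = z + pos x (a - 1) i - pos x a j + η by ring,
      dlogLax, dlogPhi]
    module
  rw [h7]
  exact h6

lemma dlogLax_mom (τ η c : ℂ) (a : ZMod n) (z : ℂ) (x : PhaseSpace N n) (i j : Fin N)
    (d : ZMod n) (m : Fin N) :
    dlogLax τ η c a z x i j (Pi.single d (Pi.single m 1), 0)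
      = if d = a then if m = j then c⁻¹ else 0 else 0 := by
  have hp : ∀ (b : ZMod n) (s : Fin N),
      posL b s ((Pi.single d (Pi.single m 1), 0) : PhaseSpace N n) = 0 := fun _ _ => rfl
  have hm : momL a j ((Pi.single d (Pi.single m 1), 0) : PhaseSpace N n)
      = if d = a then if m = j then 1 else 0 else 0 := by
    simp only [momL_apply, mom, Pi.single_apply, eq_comm (a := a)]
    split_ifs <;> simp [*]
  simp [dlogLax, hp, hm]

lemma sum_mul_sub_mul_ite {ι : Type*} [DecidableEq ι] (s : Finset ι) (f : ι → ℂ) (α β : ℂ) (m : ι) :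
    ∑ l ∈ s, f l * (α - β * if m = l then 1 else 0)
      = α * ∑ l ∈ s, f l - β * if m ∈ s then f m else 0 := by
  simp only [mul_sub, Finset.sum_sub_distrib, Finset.mul_sum]
  congr 1
  · exact Finset.sum_congr rfl fun l _ => mul_comm _ _
  · simp only [mul_ite, mul_one, mul_zero, Finset.sum_ite_eq]
    split_ifs <;> ring

/-- The partial derivatives of `log L^a_{ij}(z)` in the coordinates: the coordinates at site `a`
and those at the preceding site contribute separately, even when these sites coincide. -/
lemma dlogLax_pos (τ η c : ℂ) (a : ZMod n) (z : ℂ) (x : PhaseSpace N n) (i j : Fin N)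
    (d : ZMod n) (m : Fin N) :
    dlogLax τ η c a z x i j (0, Pi.single d (Pi.single m 1))
      = siteDelta d a * (if m = j then
            ∑ l, E1 τ (pos x a j - pos x (a - 1) l - η)
              - ∑ l ∈ Finset.univ.erase j, E1 τ (pos x a j - pos x a l) - dlogPhi τ η a z x i j
          else E1 τ (pos x a j - pos x a m))
        + siteDelta d (a - 1) * ((if m = i then dlogPhi τ η a z x i j else 0)
          - E1 τ (pos x a j - pos x (a - 1) m - η)) := by
  have hm : ∀ (b : ZMod n) (s : Fin N),
      momL b s ((0, Pi.single d (Pi.single m 1)) : PhaseSpace N n) = 0 := fun _ _ => rfl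
  have hp : ∀ (b : ZMod n) (s : Fin N),
      posL b s ((0, Pi.single d (Pi.single m 1)) : PhaseSpace N n)
        = siteDelta d b * if m = s then 1 else 0 := by
    intro b s
    simp only [posL_apply, pos, siteDelta, Pi.single_apply, eq_comm (a := b)]
    split_ifs <;> simp_all [eq_comm]
  simp only [dlogLax, add_apply, sub_apply, smul_apply, sum_apply, hm, hp, smul_eq_mul, mul_zero,
    add_zero, sum_mul_sub_mul_ite, Finset.mem_univ, Finset.mem_erase, if_true, and_true]
  split_ifs <;> first | contradiction | ring

/-- The momentum derivatives of the two factors select the columns `j` and `l`. -/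
lemma bracket_lax [NeZero n] {τ η c : ℂ} {x : PhaseSpace N n} {a b : ZMod n} {z w : ℂ} {i j k l : Fin N}
    (hF : HasLogFDerivAt (fun y => lax τ η c a z y i j) (dlogLax τ η c a z x i j) x)
    (hG : HasLogFDerivAt (fun y => lax τ η c b w y k l) (dlogLax τ η c b w x k l) x) :
    bracket (fun y => lax τ η c a z y i j) (fun y => lax τ η c b w y k l) x
      = c⁻¹ * (lax τ η c a z x i j * lax τ η c b w x k l
        * (dlogLax τ η c b w x k l (0, Pi.single a (Pi.single j 1))
          - dlogLax τ η c a z x i j (0, Pi.single b (Pi.single l 1)))) := by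
  unfold HasLogFDerivAt at hF hG
  simp only [bracket, dMom, dPos, hF.fderiv, hG.fderiv, smul_apply,
    dlogLax_mom, smul_eq_mul, mul_ite, ite_mul, mul_zero, zero_mul, Finset.sum_sub_distrib]
  have hsum : ∀ (d : ZMod n) (m : Fin N) (f : ZMod n → Fin N → ℂ),
      ∑ a, ∑ i, (if a = d then if i = m then f a i else 0 else 0) = f d m := by
    intro d m f
    rw [Finset.sum_eq_single d (fun a _ ha => by simp [ha]) (by simp)]
    simp
  rw [hsum, hsum]
  ring

end Lax

/-! ### Matrix elements of the tensors -/

section Tensor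

variable {N : ℕ}

lemma EE_apply (i j k l a b c d : Fin N) :
    EE i j k l (a, b) (c, d) = if i = a ∧ j = c ∧ k = b ∧ l = d then 1 else 0 := by
  simp only [EE, Matrix.kroneckerMap_apply, Matrix.single_apply]
  split_ifs <;> simp_all

lemma sum_smul_EE_apply (f : Fin N → Fin N → Fin N → Fin N → ℂ) (a b c d : Fin N) :
    (∑ i, ∑ j, ∑ k, ∑ l, f i j k l • EE i j k l) (a, b) (c, d) = f a c b d := by
  simp [Matrix.sum_apply, EE_apply, ite_and]

lemma sum_smul_EE_diagonal (f : Fin N → Fin N → ℂ) :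
    ∑ i, ∑ j, f i j • EE i i j j = Matrix.diagonal fun p => f p.1 p.2 := by
  ext ⟨a, b⟩ ⟨c, d⟩
  simp only [Matrix.sum_apply, Matrix.smul_apply, EE_apply, ite_and, smul_eq_mul, mul_ite, mul_one,
    mul_zero, Finset.sum_ite_eq', Finset.mem_univ, if_true, Finset.sum_ite_irrel,
    Finset.sum_const_zero, Matrix.diagonal_apply, Prod.mk.injEq]

lemma sum_smul_EE_exchange_apply (f : Fin N → Fin N → ℂ) (a b c d : Fin N) :
    (∑ i, ∑ j, f i j • EE i j j i) (a, b) (c, d) = if a = d ∧ b = c then f a b else 0 := by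
  simp only [Matrix.sum_apply, Matrix.smul_apply, EE_apply, ite_and, smul_eq_mul, mul_ite, mul_one,
    mul_zero, Finset.sum_ite_eq', Finset.mem_univ, if_true, Finset.sum_ite_irrel,
    Finset.sum_const_zero]
  split_ifs <;> simp_all

lemma sum_smul_EE_left_apply (f : Mat N) (a b c d : Fin N) :
    (∑ i, ∑ j, f i j • EE i j i i) (a, b) (c, d) = if a = b then if b = d then f a c else 0 else 0 := by
  simp only [Matrix.sum_apply, Matrix.smul_apply, EE_apply, ite_and, smul_eq_mul, mul_ite, mul_one,
    mul_zero, Finset.sum_ite_eq', Finset.mem_univ, if_true, Finset.sum_ite_irrel,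
    Finset.sum_const_zero]
  split_ifs <;> simp_all

lemma leg1_mul_apply (A : Mat N) (M : Mat2 N) (a b c d : Fin N) :
    (leg1 A * M) (a, b) (c, d) = ∑ m, A a m * M (m, b) (c, d) := by
  simp [Matrix.mul_apply, leg1, Fintype.sum_prod_type, Matrix.one_apply]

lemma leg2_mul_apply (A : Mat N) (M : Mat2 N) (a b c d : Fin N) :
    (leg2 A * M) (a, b) (c, d) = ∑ m, A b m * M (a, m) (c, d) := by
  simp [Matrix.mul_apply, leg2, Fintype.sum_prod_type, Matrix.one_apply]

lemma mul_leg1_apply (A : Mat N) (M : Mat2 N) (a b c d : Fin N) :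
    (M * leg1 A) (a, b) (c, d) = ∑ m, M (a, b) (m, d) * A m c := by
  simp [Matrix.mul_apply, leg1, Fintype.sum_prod_type, Matrix.one_apply]

lemma mul_leg2_apply (A : Mat N) (M : Mat2 N) (a b c d : Fin N) :
    (M * leg2 A) (a, b) (c, d) = ∑ m, M (a, b) (c, m) * A m d := by
  simp [Matrix.mul_apply, leg2, Fintype.sum_prod_type, Matrix.one_apply]

lemma leg1_mul_leg2 (A B : Mat N) : leg1 A * leg2 B = A ⊗ₖ B := by
  rw [leg1, leg2, ← Matrix.mul_kronecker_mul, mul_one, one_mul]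

lemma leg2_mul_leg1 (A B : Mat N) : leg2 B * leg1 A = A ⊗ₖ B := by
  rw [leg1, leg2, ← Matrix.mul_kronecker_mul, mul_one, one_mul]

lemma leg2_mul_swap12 (A : Mat N) (M : Mat2 N) :
    leg2 A * swap12 M = swap12 (leg1 A * M) := by
  ext ⟨a, b⟩ ⟨c, d⟩
  simp [swap12, leg1_mul_apply, leg2_mul_apply]

lemma swap12_sum_smul_EE_left (f : Mat N) :
    swap12 (∑ i, ∑ j, f i j • EE i j i i) = ∑ i, ∑ j, f i j • EE i i i j := by
  ext ⟨a, b⟩ ⟨c, d⟩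
  simp only [swap12, Matrix.submatrix_apply, Prod.swap_prod_mk, Matrix.sum_apply,
    Matrix.smul_apply, EE_apply]
  refine Finset.sum_congr rfl fun i _ => Finset.sum_congr rfl fun j _ => ?_
  congr 2
  exact propext ⟨fun h => ⟨h.2.2.1, h.2.2.2, h.1, h.2.1⟩, fun h => ⟨h.2.2.1, h.2.2.2, h.1, h.2.1⟩⟩

end Tensor

section Lax

variable {N n : ℕ}

lemma bracket12_apply [NeZero n] (A B : PhaseSpace N n → Mat N) (x : PhaseSpace N n)
    (i k j l : Fin N) : bracket12 A B x (i, k) (j, l)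
      = bracket (fun y => A y i j) (fun y => B y k l) x := by
  rw [bracket12, sum_smul_EE_apply fun i j k l => bracket (fun y => A y i j) (fun y => B y k l) x]

lemma leg1_lax_mul_sMat {τ η c : ℂ} {a : ZMod n} {z : ℂ} {x : PhaseSpace N n}
    (h : (lax τ η c a z x).det ≠ 0) :
    leg1 (lax τ η c a z x) * sMat τ η c a z x = ∑ i, ∑ j, dLax τ η c a z x i j • EE i j i i := by
  have hinv : lax τ η c a z x * (lax τ η c a z x)⁻¹ = 1 :=
    Matrix.mul_nonsing_inv _ (isUnit_iff_ne_zero.mpr h)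
  ext ⟨p, q⟩ ⟨r, s⟩
  have hs : ∀ m, sMat τ η c a z x (m, q) (r, s)
      = (lax τ η c a z x)⁻¹ m q * if q = s then dLax τ η c a z x q r else 0 := by
    intro m
    simp only [sMat, Matrix.sum_apply, Matrix.smul_apply, EE_apply, ite_and, smul_eq_mul, mul_ite,
      mul_one, mul_zero, Finset.sum_ite_eq', Finset.mem_univ, if_true]
  simp only [leg1_mul_apply, hs, ← mul_assoc, ← Finset.sum_mul, ← Matrix.mul_apply, hinv,
    sum_smul_EE_left_apply, Matrix.one_apply]
  split_ifs <;> simp_all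

lemma leg2_lax_mul_swap12_sMat {τ η c : ℂ} {a : ZMod n} {z : ℂ} {x : PhaseSpace N n}
    (h : (lax τ η c a z x).det ≠ 0) :
    leg2 (lax τ η c a z x) * swap12 (sMat τ η c a z x)
      = swap12 (∑ i, ∑ j, dLax τ η c a z x i j • EE i j i i) := by
  rw [leg2_mul_swap12, leg1_lax_mul_sMat h]

lemma rMat_apply_of_col (τ : ℂ) (a : ZMod n) (z w : ℂ) (x : PhaseSpace N n) (m s j l : Fin N) :
    rMat τ a z w x (m, s) (j, l)
      = (if m = l ∧ s = j then
          if j = l then E1 τ (z - w) else phi τ (z - w) (pos x a l - pos x a j) else 0)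
        - if m = j ∧ s = l then if j = l then 0 else E1 τ (pos x a j - pos x a l) else 0 := by
  have h1 : (∑ i, ∑ j, if i ≠ j then phi τ (z - w) (pos x a i - pos x a j) • EE i j j i else 0)
      = ∑ i, ∑ j, (if i = j then 0 else phi τ (z - w) (pos x a i - pos x a j)) • EE i j j i :=
    Finset.sum_congr rfl fun i _ => Finset.sum_congr rfl fun j _ => by split_ifs <;> simp_all
  have h2 : (∑ i, ∑ j, if i ≠ j then E1 τ (pos x a i - pos x a j) • EE i i j j else 0)
      = ∑ i, ∑ j, (if i = j then 0 else E1 τ (pos x a i - pos x a j)) • EE i i j j :=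
    Finset.sum_congr rfl fun i _ => Finset.sum_congr rfl fun j _ => by split_ifs <;> simp_all
  have h3 : E1 τ (z - w) • ∑ i : Fin N, EE i i i i
      = ∑ i, ∑ j, (if i = j then E1 τ (z - w) else 0) • EE i j j i := by
    rw [Finset.smul_sum]
    refine Finset.sum_congr rfl fun i _ => ?_
    simp
  rw [rMat, h1, h2, h3, sum_smul_EE_diagonal, Matrix.sub_apply, Matrix.add_apply,
    sum_smul_EE_exchange_apply, sum_smul_EE_exchange_apply, Matrix.diagonal_apply]
  simp only [Prod.mk.injEq]
  split_ifs <;> grind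

/-- Exchange of the column indices by the `r`-matrix on the right. -/
lemma kronecker_mul_rMat_apply (A B : Mat N) (τ : ℂ) (a : ZMod n) (z w : ℂ) (x : PhaseSpace N n)
    (i k j l : Fin N) :
    ((A ⊗ₖ B) * rMat τ a z w x) (i, k) (j, l)
      = A i l * B k j * (if j = l then E1 τ (z - w) else phi τ (z - w) (pos x a l - pos x a j))
        - A i j * B k l * (if j = l then 0 else E1 τ (pos x a j - pos x a l)) := by
  simp only [Matrix.mul_apply, Fintype.sum_prod_type, Matrix.kroneckerMap_apply,
    rMat_apply_of_col, mul_sub, Finset.sum_sub_distrib, ite_and, mul_ite, mul_zero,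
    Finset.sum_ite_eq', Finset.mem_univ, if_true, Finset.sum_ite_irrel, Finset.sum_const_zero]

/-- Exchange of the row indices by the `r`-matrix on the left. -/
lemma rMat_mul_kronecker_apply (A B : Mat N) (τ : ℂ) (a : ZMod n) (z w : ℂ) (x : PhaseSpace N n)
    (i k j l : Fin N) :
    (rMat τ a z w x * (A ⊗ₖ B)) (i, k) (j, l)
      = (if i = k then E1 τ (z - w) else phi τ (z - w) (pos x a i - pos x a k)) * (A k j * B i l)
        - (if i = k then 0 else E1 τ (pos x a i - pos x a k)) * (A i j * B k l) := by
  have h : ∀ m s, rMat τ a z w x (i, k) (m, s) = (if m = k then if s = i then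
          if i = k then E1 τ (z - w) else phi τ (z - w) (pos x a i - pos x a k) else 0 else 0)
        - if m = i then if s = k then if i = k then 0 else E1 τ (pos x a i - pos x a k)
          else 0 else 0 := by
    intro m s
    rw [rMat_apply_of_col]
    split_ifs <;> grind
  simp only [Matrix.mul_apply, Fintype.sum_prod_type, Matrix.kroneckerMap_apply,
    h, sub_mul, Finset.sum_sub_distrib, ite_mul, zero_mul,
    Finset.sum_ite_eq', Finset.mem_univ, if_true, Finset.sum_ite_irrel, Finset.sum_const_zero]

lemma uPlus_eq_diagonal (τ η : ℂ) (a : ZMod n) (x : PhaseSpace N n) :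
    uPlus τ η a x = Matrix.diagonal fun p => E1 τ (pos x (a - 1) p.2 - pos x a p.1 + η) :=
  sum_smul_EE_diagonal fun i j => E1 τ (pos x (a - 1) j - pos x a i + η)

lemma uMinus_eq_neg_diagonal (τ η : ℂ) (a : ZMod n) (x : PhaseSpace N n) :
    uMinus τ η a x = -Matrix.diagonal fun p => E1 τ (pos x (a - 1) p.1 - pos x a p.2 + η) := by
  rw [uMinus, sum_smul_EE_diagonal fun i j => E1 τ (pos x (a - 1) i - pos x a j + η)]

lemma leg1_mul_sPlus_apply {τ η c : ℂ} {a : ZMod n} {z : ℂ} {x : PhaseSpace N n}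
    (h : (lax τ η c a z x).det ≠ 0) (i k j l : Fin N) :
    (leg1 (lax τ η c a z x) * sPlus τ η c a z x) (i, k) (j, l)
      = lax τ η c a z x i j * if k = l then
        (if i = k then dlogPhi τ η a z x i j else 0) + E1 τ (pos x (a - 1) k - pos x a j + η)
        else 0 := by
  rw [sPlus, mul_add, leg1_lax_mul_sMat h, uPlus_eq_diagonal, Matrix.add_apply,
    sum_smul_EE_left_apply, Matrix.mul_diagonal, leg1, Matrix.kroneckerMap_apply, Matrix.one_apply]
  simp only [dLax, Matrix.of_apply, dlogPhi]
  split_ifs <;> simp_all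
  ring

lemma leg2_mul_sMinus_apply {τ η c : ℂ} {a : ZMod n} {z : ℂ} {x : PhaseSpace N n}
    (h : (lax τ η c a z x).det ≠ 0) (i k j l : Fin N) :
    (leg2 (lax τ η c a z x) * sMinus τ η c a z x) (i, k) (j, l)
      = lax τ η c a z x k l * if i = j then
        (if i = k then dlogPhi τ η a z x k l else 0) + E1 τ (pos x (a - 1) i - pos x a l + η)
        else 0 := by
  rw [sMinus, mul_sub, leg2_lax_mul_swap12_sMat h, uMinus_eq_neg_diagonal, mul_neg, sub_neg_eq_add,
    Matrix.add_apply, swap12, Matrix.submatrix_apply, Prod.swap_prod_mk, Prod.swap_prod_mk,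
    sum_smul_EE_left_apply, Matrix.mul_diagonal, leg2, Matrix.kroneckerMap_apply, Matrix.one_apply]
  simp only [dLax, Matrix.of_apply, dlogPhi]
  split_ifs <;> simp_all
  ring

lemma lax_mul_lax_mul_sPlus_apply {τ η c : ℂ} {a : ZMod n} {z : ℂ} {x : PhaseSpace N n}
    (h : (lax τ η c a z x).det ≠ 0) (B : Mat N) (i k j l : Fin N) :
    (leg1 (lax τ η c a z x) * leg2 B * sPlus τ η c a z x) (i, k) (j, l)
      = lax τ η c a z x i j * B k l
        * ((if i = l then dlogPhi τ η a z x i j else 0) + E1 τ (pos x (a - 1) l - pos x a j + η)) := by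
  rw [leg1_mul_leg2, ← leg2_mul_leg1, mul_assoc, leg2_mul_apply]
  simp only [leg1_mul_sPlus_apply h, mul_ite, mul_zero, Finset.sum_ite_eq', Finset.mem_univ,
    if_true]
  ring

lemma lax_mul_lax_mul_sMinus_apply {τ η c : ℂ} {a : ZMod n} {z : ℂ} {x : PhaseSpace N n}
    (h : (lax τ η c a z x).det ≠ 0) (B : Mat N) (i k j l : Fin N) :
    (leg1 B * leg2 (lax τ η c a z x) * sMinus τ η c a z x) (i, k) (j, l)
      = B i j * lax τ η c a z x k l
        * ((if j = k then dlogPhi τ η a z x k l else 0) + E1 τ (pos x (a - 1) j - pos x a l + η)) := by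
  rw [mul_assoc, leg1_mul_apply]
  simp only [leg2_mul_sMinus_apply h, mul_ite, mul_zero, Finset.sum_ite_eq', Finset.mem_univ,
    if_true]
  ring

lemma lax_mul_sPlus_mul_apply {τ η c : ℂ} {a : ZMod n} {z : ℂ} {x : PhaseSpace N n}
    (h : (lax τ η c a z x).det ≠ 0) (B : Mat N) (i k j l : Fin N) :
    (leg1 (lax τ η c a z x) * sPlus τ η c a z x * leg2 B) (i, k) (j, l)
      = lax τ η c a z x i j * B k l
        * ((if i = k then dlogPhi τ η a z x i j else 0) + E1 τ (pos x (a - 1) k - pos x a j + η)) := by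
  rw [mul_leg2_apply]
  simp only [leg1_mul_sPlus_apply h, mul_ite, ite_mul, mul_zero, zero_mul, Finset.sum_ite_eq,
    Finset.mem_univ, if_true]
  ring

lemma lax_mul_sMinus_mul_apply {τ η c : ℂ} {a : ZMod n} {z : ℂ} {x : PhaseSpace N n}
    (h : (lax τ η c a z x).det ≠ 0) (B : Mat N) (i k j l : Fin N) :
    (leg2 (lax τ η c a z x) * sMinus τ η c a z x * leg1 B) (i, k) (j, l)
      = B i j * lax τ η c a z x k l
        * ((if i = k then dlogPhi τ η a z x k l else 0) + E1 τ (pos x (a - 1) i - pos x a l + η)) := by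
  rw [mul_leg1_apply]
  simp only [leg2_mul_sMinus_apply h, mul_ite, ite_mul, mul_zero, zero_mul, Finset.sum_ite_eq,
    Finset.mem_univ, if_true]
  ring

end Lax

/-! ### The quadratic bracket -/

section Lax

variable {N n : ℕ}

/-- The factor of `L^a_{ij}(z)` next to the Kronecker function; it depends on `j` only. -/
noncomputable def laxWeight (τ η c : ℂ) (a : ZMod n) (x : PhaseSpace N n) (j : Fin N) : ℂ :=
  (∏ l, theta τ (pos x a j - pos x (a - 1) l - η))
      / (theta τ (-η) * ∏ l ∈ Finset.univ.erase j, theta τ (pos x a j - pos x a l))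
    * Complex.exp (mom x a j / c)

lemma lax_apply (τ η c : ℂ) (a : ZMod n) (z : ℂ) (x : PhaseSpace N n) (i j : Fin N) :
    lax τ η c a z x i j
      = phi τ z (pos x (a - 1) i - pos x a j + η) * laxWeight τ η c a x j := by
  rw [lax, Matrix.of_apply, laxWeight, mul_assoc]

/-- The part of the bracket at one site, on matrix elements: the identities between Kronecker
functions, sorted by whether the row and the column indices coincide. The function `σ`, which
stands for the derivative of the factor without spectral parameter, drops out. -/
lemma lax_exchange {τ η c : ℂ} (hτ : 0 < τ.im) {x : PhaseSpace N n}
    (hq : ∀ (a : ZMod n) (i j : Fin N), i ≠ j → theta τ (pos x a i - pos x a j) ≠ 0)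
    (hqη : ∀ (a : ZMod n) (i j : Fin N), theta τ (pos x (a - 1) i - pos x a j + η) ≠ 0)
    {z w : ℂ} (hz : theta τ z ≠ 0) (hw : theta τ w ≠ 0) (hzw : theta τ (z - w) ≠ 0) {b : ZMod n}
    (hzb : ∀ i j : Fin N, theta τ (z + pos x (b - 1) i - pos x b j + η) ≠ 0)
    (hwb : ∀ i j : Fin N, theta τ (w + pos x (b - 1) i - pos x b j + η) ≠ 0)
    (hLz : (lax τ η c b z x).det ≠ 0) (hLw : (lax τ η c b w x).det ≠ 0)
    (σ : Fin N → ℂ) (i k j l : Fin N) :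
    lax τ η c b z x i j * lax τ η c b w x k l
        * ((if j = l then σ l - dlogPhi τ η b w x k l else E1 τ (pos x b l - pos x b j))
          - (if l = j then σ j - dlogPhi τ η b z x i j else E1 τ (pos x b j - pos x b l)))
      = (leg1 (lax τ η c b z x) * leg2 (lax τ η c b w x) * rMat τ b z w x
            - rMat τ (b - 1) z w x * leg1 (lax τ η c b z x) * leg2 (lax τ η c b w x)
            + leg1 (lax τ η c b z x) * sPlus τ η c b z x * leg2 (lax τ η c b w x)
            - leg2 (lax τ η c b w x) * sMinus τ η c b w x * leg1 (lax τ η c b z x))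
          (i, k) (j, l) := by
  rw [mul_assoc (rMat τ (b - 1) z w x), leg1_mul_leg2, Matrix.sub_apply, Matrix.add_apply,
    Matrix.sub_apply, kronecker_mul_rMat_apply, rMat_mul_kronecker_apply,
    lax_mul_sPlus_mul_apply hLz, lax_mul_sMinus_mul_apply hLw]
  have hzb' : ∀ i j, theta τ (z + (pos x (b - 1) i - pos x b j + η)) ≠ 0 := fun i j => by
    convert hzb i j using 2; ring
  have hwb' : ∀ i j, theta τ (w + (pos x (b - 1) i - pos x b j + η)) ≠ 0 := fun i j => by
    convert hwb i j using 2; ring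
  -- serves the two cases in which exactly one of the index pairs coincides
  have hsub : ∀ i j k l, theta τ (pos x (b - 1) i - pos x b j - (pos x (b - 1) k - pos x b l)) ≠ 0 →
      (E1 τ (pos x (b - 1) i - pos x b j - (pos x (b - 1) k - pos x b l)) + E1 τ (z - w)
          + E1 τ (w + pos x (b - 1) k - pos x b l + η) - E1 τ (z + pos x (b - 1) i - pos x b j + η))
        * (phi τ z (pos x (b - 1) i - pos x b j + η) * phi τ w (pos x (b - 1) k - pos x b l + η))
      = phi τ (z - w) (pos x (b - 1) i - pos x b j - (pos x (b - 1) k - pos x b l))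
        * phi τ z (pos x (b - 1) k - pos x b l + η)
        * phi τ w (pos x (b - 1) i - pos x b j + η) := by
    intro i j k l h
    have h1 : pos x (b - 1) i - pos x b j + η - (pos x (b - 1) k - pos x b l + η)
      = pos x (b - 1) i - pos x b j - (pos x (b - 1) k - pos x b l) := by ring
    have h2 := E1_mul_phi_mul_phi_of_sub hτ hz hw hzw (hqη b i j) (hqη b k l) (by rwa [h1])
      (hzb' i j) (hwb' k l)
    rw [h1] at h2
    simp only [← add_assoc, ← add_sub_assoc] at h2
    exact h2
  have hq' : ∀ i k, i ≠ k → theta τ (pos x (b - 1) i - pos x (b - 1) k) ≠ 0 := hq (b - 1)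
  simp only [lax_apply, dlogPhi]
  by_cases hik : i = k <;> by_cases hjl : j = l
  · subst hik hjl
    simp only [if_true]
    ring
  · subst hik
    have hjl' : pos x (b - 1) i - pos x b j - (pos x (b - 1) i - pos x b l)
      = pos x b l - pos x b j := by ring
    have h := hsub i j i l (by rw [hjl']; exact hq b l j (Ne.symm hjl))
    rw [hjl'] at h
    simp only [if_neg hjl, if_neg (Ne.symm hjl), if_true]
    rw [← neg_sub (pos x b l) (pos x b j), E1_neg]
    linear_combination laxWeight τ η c b x j * laxWeight τ η c b x l * h
  · subst hjl
    have hik' : pos x (b - 1) i - pos x b j - (pos x (b - 1) k - pos x b j)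
      = pos x (b - 1) i - pos x (b - 1) k := by ring
    have h := hsub i j k j (by rw [hik']; exact hq' i k hik)
    rw [hik'] at h
    simp only [if_neg hik, if_true]
    linear_combination -laxWeight τ η c b x j ^ 2 * h
  · have h := E1_mul_phi_mul_phi hτ (x := pos x (b - 1) i + η) (y := pos x (b - 1) k + η)
      (s := pos x b j) (t := pos x b l) hz hw hzw
      (by convert hqη b i j using 2; ring) (by convert hqη b i l using 2; ring)
      (by convert hqη b k j using 2; ring) (by convert hqη b k l using 2; ring)
      (by convert hq' i k hik using 2; ring) (hq b l j (Ne.symm hjl))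
    simp only [add_sub_add_right_eq_sub] at h
    simp only [add_sub_right_comm] at h
    simp only [if_neg hik, if_neg hjl, if_neg (Ne.symm hjl)]
    rw [← neg_sub (pos x b l) (pos x b j), E1_neg]
    linear_combination laxWeight τ η c b x j * laxWeight τ η c b x l * h

/-- Comparison of the contributions of neighbouring sites one Kronecker symbol at a time. For
`n ≤ 2` several of the three conditions hold at once, so this is not a case distinction. -/
lemma siteDelta_combination {a b : ZMod n} {P X X' Y Y' F G H : ℂ}
    (hF : a = b → P * (X - X') = F) (hG : a = b - 1 → P * Y = G) (hH : a = b + 1 → P * Y' = H) :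
    P * (siteDelta a b * X + siteDelta a (b - 1) * Y
        - (siteDelta b a * X' + siteDelta b (a - 1) * Y'))
      = siteDelta a b * F + siteDelta a (b - 1) * G - siteDelta a (b + 1) * H := by
  have h : ∀ {d : ZMod n} {u v : ℂ}, (a = d → u = v) → siteDelta a d * u = siteDelta a d * v := by
    intro d u v huv
    by_cases had : a = d
    · rw [huv had]
    · simp [siteDelta, had]
  have hba : siteDelta b a = siteDelta a b := by simp only [siteDelta, eq_comm]
  have hba' : siteDelta b (a - 1) = siteDelta a (b + 1) := by
    simp only [siteDelta, eq_sub_iff_add_eq, eq_comm]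
  rw [hba, hba']
  linear_combination h hF + h hG - h hH

end Lax

end RuijsenaarsChain

theorem theorem1 {N n : ℕ} [NeZero n] (τ η c : ℂ) (hτ : 0 < τ.im) (hc : c ≠ 0)
    (hη : theta τ η ≠ 0)
    (x : PhaseSpace N n)
    (hq : ∀ (a : ZMod n) (i j : Fin N), i ≠ j → theta τ (pos x a i - pos x a j) ≠ 0)
    (hqη : ∀ (a : ZMod n) (i j : Fin N), theta τ (pos x (a - 1) i - pos x a j + η) ≠ 0)
    (z w : ℂ) (hz : theta τ z ≠ 0) (hw : theta τ w ≠ 0) (hzw : theta τ (z - w) ≠ 0)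
    (a b : ZMod n)
    (hza : ∀ i j : Fin N, theta τ (z + pos x (a - 1) i - pos x a j + η) ≠ 0)
    (hwb : ∀ i j : Fin N, theta τ (w + pos x (b - 1) i - pos x b j + η) ≠ 0)
    (hLa : (lax τ η c a z x).det ≠ 0) (hLb : (lax τ η c b w x).det ≠ 0) :
    -- the entries of the Lax matrices are differentiable at `x`
    (∀ i j : Fin N, DifferentiableAt ℂ (fun y : PhaseSpace N n => lax τ η c a z y i j) x) ∧
    (∀ i j : Fin N, DifferentiableAt ℂ (fun y : PhaseSpace N n => lax τ η c b w y i j) x) ∧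
    -- the relations that determine `s_{12}` and `s_{21}`
    leg1 (lax τ η c a z x) * sMat τ η c a z x
      = ∑ i, ∑ j, (lax τ η c a z x i j
          * (E1 τ (z + pos x (a - 1) i - pos x a j + η)
            - E1 τ (pos x (a - 1) i - pos x a j + η))) • EE i j i i ∧
    leg2 (lax τ η c b w x) * swap12 (sMat τ η c b w x)
      = ∑ i, ∑ j, (lax τ η c b w x i j
          * (E1 τ (w + pos x (b - 1) i - pos x b j + η)
            - E1 τ (pos x (b - 1) i - pos x b j + η))) • EE i i i j ∧
    -- the quadratic `r`-matrix structure
    c • bracket12 (lax τ η c a z) (lax τ η c b w) x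
      = siteDelta a b •
          (leg1 (lax τ η c b z x) * leg2 (lax τ η c b w x) * rMat τ b z w x
            - rMat τ (b - 1) z w x * leg1 (lax τ η c b z x) * leg2 (lax τ η c b w x)
            + leg1 (lax τ η c b z x) * sPlus τ η c b z x * leg2 (lax τ η c b w x)
            - leg2 (lax τ η c b w x) * sMinus τ η c b w x * leg1 (lax τ η c b z x))
        + siteDelta a (b - 1) •
          (leg1 (lax τ η c (b - 1) z x) * leg2 (lax τ η c b w x) * sMinus τ η c b w x)
        - siteDelta a (b + 1) •
          (leg1 (lax τ η c (b + 1) z x) * leg2 (lax τ η c b w x)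
            * sPlus τ η c (b + 1) z x) := by
  have hF := hasLogFDerivAt_lax c hτ hη hq hqη hz hza
  have hG := hasLogFDerivAt_lax c hτ hη hq hqη hw hwb
  refine ⟨fun i j => (hF i j).differentiableAt, fun i j => (hG i j).differentiableAt,
    leg1_lax_mul_sMat hLa, ?_, ?_⟩
  · rw [leg2_lax_mul_swap12_sMat hLb, swap12_sum_smul_EE_left]
    rfl
  · ext ⟨i, k⟩ ⟨j, l⟩
    have hneg : ∀ u v : ℂ, E1 τ (u - v - η) = -E1 τ (v - u + η) := fun u v => by
      rw [← E1_neg]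
      congr 1
      ring
    rw [Matrix.smul_apply, bracket12_apply, bracket_lax (hF i j) (hG k l), smul_eq_mul,
      mul_inv_cancel_left₀ hc, dlogLax_pos, dlogLax_pos, hneg, hneg, Matrix.sub_apply,
      Matrix.add_apply, Matrix.smul_apply, Matrix.smul_apply, Matrix.smul_apply, smul_eq_mul,
      smul_eq_mul, smul_eq_mul]
    refine siteDelta_combination (fun h => ?_) (fun h => ?_) (fun h => ?_)
    · subst h
      -- the derivative of the factor without spectral parameter, the same on both sides
      exact lax_exchange hτ hq hqη hz hw hzw hza hwb hLa hLb
        (fun j => ∑ l, E1 τ (pos x a j - pos x (a - 1) l - η)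
          - ∑ l ∈ Finset.univ.erase j, E1 τ (pos x a j - pos x a l)) i k j l
    · subst h
      rw [lax_mul_lax_mul_sMinus_apply hLb, sub_neg_eq_add]
    · subst h
      rw [lax_mul_lax_mul_sPlus_apply hLa, sub_neg_eq_add]
      simp only [eq_comm (a := l)]
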